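/- Let $G$ be a locally compact, $\sigma$-compact (Hausdorff) abelian topological group acting continuously, $(t,x)\mapsto t\cdot x$, on a nonempty compact metric space $(X,d)$, and assume that the system $(X,G)$ is minimal, i.e. every orbit is dense. Let $\pi_{max}:X\to X_{max}$ be the maximal equicontinuous factor of $(X,G)$, i.e. the equicontinuous factor of which every equicontinuous factor of $(X,G)$ is a factor. Call $x,y\in X$ proximal if for every $\varepsilon>0$ there is $t\in G$ with $d(t\cdot x,t\cdot y)<\varepsilon$, and call $x\in X$ distal if it is proximal to no point other than itself; let $X^{distal}$ be the set of distal points. Let $X_{max}^{distal}$ be the set of fiber-distal points, i.e. of those $\xi\in X_{max}$ for which all points of the fiber $\pi_{max}^{-1}(\xi)$ are distal. Let $X_{max}^{open}$ be the set of fiber-open points, i.e. of those $\xi\in X_{max}$ such that at every $x\in\pi_{max}^{-1}(\xi)$ the map $\pi_{max}$ is open (it maps neighbourhoods of $x$ to neighbourhoods of $\xi$). The minimal rank $mr\in\mathbb N\cup\{+\infty\}$ is the minimal number of points in a fiber of $\pi_{max}$. The coincidence rank $cr\in\mathbb N\cup\{+\infty\}$ is the supremum, over $\xi\in X_{max}$,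 of the cardinalities of subsets of $\pi_{max}^{-1}(\xi)$ whose elements are pairwise non-proximal. Suppose $cr<\infty$. Then the following are equivalent: (i) $cr=mr$; (ii) $X_{max}^{distal}\neq\emptyset$; (iii) the system is point distal, i.e. $X^{distal}\neq\emptyset$; (iv) $X_{max}^{distal}=X_{max}^{open}$. -/

import Mathlib

open Set Filter Topology

universe u v

namespace TopDyn

section General

variable (G : Type v) [Group G]

/-- A factor map of dynamical systems over `G`: continuous, onto and `G`-equivariant. -/
structure IsFactorMap {X Y : Type*} [TopologicalSpace X] [TopologicalSpace Y]
    [MulAction G X] [MulAction G Y] (π : X → Y) : Prop where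
  continuous : Continuous π
  surjective : Function.Surjective π
  map_smul : ∀ (t : G) (x : X), π (t • x) = t • π x

/-- Equicontinuity of the family of translations `x ↦ t • x`, `t : G`, on a compact Hausdorff
space, whose unique uniformity is the filter of neighbourhoods of the diagonal. -/
def IsEquicontinuous (Y : Type*) [TopologicalSpace Y] [MulAction G Y] : Prop :=
  ∀ U ∈ 𝓝ˢ (diagonal Y), ∃ V ∈ 𝓝ˢ (diagonal Y),
    ∀ p ∈ V, ∀ t : G, (t • p.1, t • p.2) ∈ U

/-- On a compact metric space this is the usual epsilon-delta condition. -/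
theorem isEquicontinuous_iff_dist (Y : Type*) [MetricSpace Y] [CompactSpace Y] [MulAction G Y] :
    IsEquicontinuous G Y ↔ ∀ ε > 0, ∃ δ > 0, ∀ (t : G) (x y : Y),
      dist x y < δ → dist (t • x) (t • y) < ε := by
  unfold IsEquicontinuous
  rw [nhdsSet_diagonal_eq_uniformity]
  constructor
  · intro h ε hε
    obtain ⟨V, hV, hVU⟩ := h _ (Metric.dist_mem_uniformity hε)
    obtain ⟨δ, hδ, hδV⟩ := Metric.mem_uniformity_dist.1 hV
    exact ⟨δ, hδ, fun t x y hxy => hVU (x, y) (hδV hxy) t⟩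
  · intro h U hU
    obtain ⟨ε, hε, hεU⟩ := Metric.mem_uniformity_dist.1 hU
    obtain ⟨δ, hδ, hδ'⟩ := h ε hε
    exact ⟨_, Metric.dist_mem_uniformity hδ, fun p hp t => hεU (hδ' t p.1 p.2 hp)⟩

variable (X : Type u) [TopologicalSpace X] [MulAction G X]

/-- The equicontinuous structure relation: `x` and `y` are related iff they have the same image
in every equicontinuous factor of `(X, G)`. Factors of `X` may be taken in the universe of `X`, and
for compact `X` they inherit joint continuity of the action. -/
def maxEquicontinuousSetoid : Setoid X where
  r x y := ∀ (Y : Type u) [TopologicalSpace Y] [CompactSpace Y] [T2Space Y] [MulAction G Y]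
    (π : X → Y), IsFactorMap G π → IsEquicontinuous G Y → π x = π y
  iseqv :=
    { refl := fun _ _ _ _ _ _ _ _ _ => rfl
      symm := fun h Y _ _ _ _ π hπ hY => (h Y π hπ hY).symm
      trans := fun h h' Y _ _ _ _ π hπ hY => (h Y π hπ hY).trans (h' Y π hπ hY) }

/-- The maximal equicontinuous factor `X_max` of `(X, G)`, with the quotient topology. It is
shown below to be an equicontinuous factor of which every equicontinuous factor is a factor. -/
def MaxEquicontinuousFactor : Type u := Quotient (maxEquicontinuousSetoid G X)

/-- The factor map from `X` onto `X_max`. -/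
def piMax : X → MaxEquicontinuousFactor G X := Quotient.mk (maxEquicontinuousSetoid G X)

instance : TopologicalSpace (MaxEquicontinuousFactor G X) :=
  inferInstanceAs (TopologicalSpace (Quotient (maxEquicontinuousSetoid G X)))

instance [CompactSpace X] : CompactSpace (MaxEquicontinuousFactor G X) :=
  inferInstanceAs (CompactSpace (Quotient (maxEquicontinuousSetoid G X)))

/-- The induced action of `G` on `X_max`. -/
instance : MulAction G (MaxEquicontinuousFactor G X) where
  smul t := Quotient.map (fun x : X => t • x) (fun x y h Y _ _ _ _ π hπ hY => by
    rw [hπ.map_smul, hπ.map_smul, h Y π hπ hY])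
  one_smul := by
    rintro ⟨x⟩
    exact congrArg (piMax G X) (one_smul G x)
  mul_smul := by
    rintro s t ⟨x⟩
    exact congrArg (piMax G X) (mul_smul s t x)

variable {X}

theorem isQuotientMap_piMax : IsQuotientMap (piMax G X) := isQuotientMap_quotient_mk'

theorem piMax_eq_iff {x y : X} :
    piMax G X x = piMax G X y ↔ maxEquicontinuousSetoid G X x y := Quotient.eq

variable (X)

theorem isFactorMap_piMax : IsFactorMap G (piMax G X) where
  continuous := (isQuotientMap_piMax G).continuous
  surjective := (isQuotientMap_piMax G).surjective
  map_smul _ _ := rfl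

/-- Every factor map onto an equicontinuous system factors through `X_max`. -/
theorem exists_isFactorMap_of_isEquicontinuous {Y : Type u} [TopologicalSpace Y]
    [CompactSpace Y] [T2Space Y] [MulAction G Y] {π : X → Y} (hπ : IsFactorMap G π)
    (hY : IsEquicontinuous G Y) :
    ∃ ρ : MaxEquicontinuousFactor G X → Y, IsFactorMap G ρ ∧ ρ ∘ piMax G X = π := by
  refine ⟨Quotient.lift π (fun x y h => h Y π hπ hY), ⟨?_, ?_, ?_⟩, rfl⟩
  · exact hπ.continuous.quotient_lift _
  · intro y
    obtain ⟨x, rfl⟩ := hπ.surjective y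
    exact ⟨piMax G X x, rfl⟩
  · rintro t ⟨x⟩
    exact hπ.map_smul t x

/-- Distinct points of `X_max` are separated by an equicontinuous factor. -/
theorem exists_factor_ne {a b : MaxEquicontinuousFactor G X} (hab : a ≠ b) :
    ∃ (Y : Type u) (_ : TopologicalSpace Y) (_ : CompactSpace Y) (_ : T2Space Y)
      (_ : MulAction G Y) (ρ : MaxEquicontinuousFactor G X → Y),
      IsFactorMap G ρ ∧ IsEquicontinuous G Y ∧ ρ a ≠ ρ b := by
  obtain ⟨x, rfl⟩ := (isQuotientMap_piMax G).surjective a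
  obtain ⟨y, rfl⟩ := (isQuotientMap_piMax G).surjective b
  by_contra! hcon
  apply hab
  rw [piMax_eq_iff]
  intro Y _ _ _ _ π hπ hY
  obtain ⟨ρ, hρ, rfl⟩ := exists_isFactorMap_of_isEquicontinuous G X hπ hY
  exact hcon Y _ ‹_› ‹_› _ ρ hρ hY

instance : T2Space (MaxEquicontinuousFactor G X) := by
  refine ⟨fun a b hab => ?_⟩
  obtain ⟨Y, _, _, _, _, ρ, hρ, -, hne⟩ := exists_factor_ne G X hab
  exact separated_by_continuous hρ.continuous hne

instance [TopologicalSpace G] [CompactSpace X] [ContinuousSMul G X] :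
    ContinuousSMul G (MaxEquicontinuousFactor G X) := by
  have hprop : IsProperMap (piMax G X) :=
    isProperMap_iff_isClosedMap_and_compact_fibers.2
      ⟨(isFactorMap_piMax G X).continuous, ?_, ?_⟩
  · have hq : IsQuotientMap (Prod.map (id : G → G) (piMax G X)) :=
      ((isProperMap_id (X := G)).prodMap hprop).isClosedMap.isQuotientMap
        (continuous_id.prodMap (isFactorMap_piMax G X).continuous)
        (Function.surjective_id.prodMap (isFactorMap_piMax G X).surjective)
    refine ⟨hq.continuous_iff.2 ?_⟩
    exact (isFactorMap_piMax G X).continuous.comp (continuous_smul (M := G) (X := X))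
  · intro K hK
    exact (hK.isCompact.image (isFactorMap_piMax G X).continuous).isClosed
  · intro ξ
    exact (isClosed_singleton.preimage (isFactorMap_piMax G X).continuous).isCompact

/-- `X_max` is equicontinuous. -/
theorem isEquicontinuous_max [CompactSpace X] :
    IsEquicontinuous G (MaxEquicontinuousFactor G X) := by
  intro U hU
  obtain ⟨O, hO, hdO, hOU⟩ := mem_nhdsSet_iff_exists.1 hU
  have hK : IsCompact Oᶜ := hO.isClosed_compl.isCompact
  suffices h : ∃ V ∈ 𝓝ˢ (diagonal (MaxEquicontinuousFactor G X)),
      ∀ p ∈ V, ∀ t : G, (t • p.1, t • p.2) ∉ Oᶜ by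
    obtain ⟨V, hV, h⟩ := h
    exact ⟨V, hV, fun p hp t => hOU (not_not.1 (h p hp t))⟩
  refine hK.induction_on (p := fun S => ∃ V ∈ 𝓝ˢ (diagonal (MaxEquicontinuousFactor G X)),
      ∀ p ∈ V, ∀ t : G, (t • p.1, t • p.2) ∉ S) ?_ ?_ ?_ ?_
  · exact ⟨univ, univ_mem, fun _ _ _ h => h⟩
  · rintro S T hST ⟨V, hV, h⟩
    exact ⟨V, hV, fun p hp t hS => h p hp t (hST hS)⟩
  · rintro S T ⟨V, hV, h⟩ ⟨W, hW, h'⟩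
    exact ⟨V ∩ W, inter_mem hV hW, fun p hp t hS => hS.elim (h p hp.1 t) (h' p hp.2 t)⟩
  · rintro ⟨a, b⟩ hab
    have hne : a ≠ b := by
      rintro rfl
      exact hab (hdO rfl)
    obtain ⟨Y, _, _, _, _, ρ, hρ, hY, hρne⟩ := exists_factor_ne G X hne
    obtain ⟨A, B, hA, hB, haA, hbB, hAB⟩ := t2_separation hρne
    have hdisj : diagonal Y ⊆ (A ×ˢ B)ᶜ := by
      rintro ⟨y, z⟩ (rfl : y = z) ⟨h1, h2⟩
      exact disjoint_left.1 hAB h1 h2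
    obtain ⟨A', hA', hcl⟩ : ∃ A' ∈ 𝓝 (ρ a), IsClosed A' ∧ A' ⊆ A := by
      obtain ⟨s, hs, h1, h2⟩ := exists_mem_nhds_isClosed_subset (hA.mem_nhds haA)
      exact ⟨s, hs, h1, h2⟩
    obtain ⟨B', hB', hcl'⟩ : ∃ B' ∈ 𝓝 (ρ b), IsClosed B' ∧ B' ⊆ B := by
      obtain ⟨s, hs, h1, h2⟩ := exists_mem_nhds_isClosed_subset (hB.mem_nhds hbB)
      exact ⟨s, hs, h1, h2⟩
    have hW : (A' ×ˢ B')ᶜ ∈ 𝓝ˢ (diagonal Y) :=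
      (hcl.1.prod hcl'.1).isOpen_compl.mem_nhdsSet.2
        (hdisj.trans (compl_subset_compl.2 (prod_mono hcl.2 hcl'.2)))
    obtain ⟨V, hV, hVW⟩ := hY _ hW
    have hc : Continuous (Prod.map ρ ρ) := hρ.continuous.prodMap hρ.continuous
    refine ⟨Prod.map ρ ρ ⁻¹' (A' ×ˢ B'), ?_, Prod.map ρ ρ ⁻¹' V, ?_, ?_⟩
    · exact mem_nhdsWithin_of_mem_nhds
        (hc.continuousAt.preimage_mem_nhds (prod_mem_nhds hA' hB'))
    · have : MapsTo (Prod.map ρ ρ) (diagonal (MaxEquicontinuousFactor G X)) (diagonal Y) := by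
        rintro ⟨x, y⟩ (rfl : x = y)
        rfl
      exact hc.tendsto_nhdsSet this hV
    · rintro ⟨x, y⟩ hp t ht
      refine hVW _ hp t ?_
      have e : Prod.map ρ ρ (t • x, t • y) = (t • ρ x, t • ρ y) :=
        Prod.ext (hρ.map_smul t x) (hρ.map_smul t y)
      change (t • ρ x, t • ρ y) ∈ _
      rw [← e]
      exact ht

end General

section Metric

variable (G : Type v) [Group G] (X : Type u) [MetricSpace X] [MulAction G X]

/-- The relation `P_ε`. -/
def ProxWithin (ε : ℝ) (x y : X) : Prop := ∃ t : G, dist (t • x) (t • y) < ε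

/-- The proximality relation `P`, the intersection of all `P_ε`, `ε > 0`. -/
def Proximal (x y : X) : Prop := ∀ ε > 0, ProxWithin G X ε x y

/-- `X^distal`: the points that are proximal only to themselves. -/
def distalPoints : Set X := {x | ∀ y, Proximal G X x y → y = x}

/-- A system is point distal if it has a distal point. -/
def IsPointDistal : Prop := (distalPoints G X).Nonempty

/-- The fiber of `π_max` over `ξ`. -/
def fiber (ξ : MaxEquicontinuousFactor G X) : Set X := piMax G X ⁻¹' {ξ}

/-- The fiber-distal points of `X_max`: all points in the fiber are distal. -/
def fiberDistalPoints : Set (MaxEquicontinuousFactor G X) :=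
  {ξ | fiber G X ξ ⊆ distalPoints G X}

/-- `X^open`: the points at which `π_max` maps neighbourhoods to neighbourhoods. -/
def openPoints : Set X := {x | ∀ U ∈ 𝓝 x, piMax G X '' U ∈ 𝓝 (piMax G X x)}

/-- The fiber-open points of `X_max`: all points in the fiber are open. -/
def fiberOpenPoints : Set (MaxEquicontinuousFactor G X) :=
  {ξ | fiber G X ξ ⊆ openPoints G X}

/-- The minimal rank: the least number of points in a fiber of `π_max`. -/
noncomputable def minimalRank : ℕ∞ := ⨅ ξ : MaxEquicontinuousFactor G X, (fiber G X ξ).encard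

/-- The coincidence rank: the supremum, over all fibers of `π_max`, of the cardinalities of
subsets of the fiber whose elements are pairwise non-proximal. -/
noncomputable def coincidenceRank : ℕ∞ :=
  ⨆ ξ : MaxEquicontinuousFactor G X,
    ⨆ S ∈ {S : Set X | S ⊆ fiber G X ξ ∧ S.Pairwise fun x y => ¬ Proximal G X x y}, S.encard

end Metric

end TopDyn

namespace TopDyn

open scoped Pointwise

/-! ### Proximality, separated tuples and cardinalities of fibers -/

section Metric

variable {G : Type v} [Group G] {X : Type u} [MetricSpace X] [MulAction G X]

/-! Everything rests on tuples of `n = cr` points in one fiber whose orbits stay uniformly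
`δ`-apart. They form a closed invariant set, so by compactness and minimality every point of `X` is
an entry of such a tuple. Hence all fibers have at least `n` points, so `cr ≤ mr`. A fiber with
exactly `n` points is filled by one tuple and is therefore distal; conversely, a distal fiber has at
most `n` points.

The implications run (i) ⇒ (iv) ⇒ (ii) ⇒ (iii) ⇒ (i). Distal fibers are open because limits of
separated tuples are separated tuples; open fibers have the least cardinality `mr`, hence are distal
when `cr = mr`; open fibers exist by Baire category. If there is a distal point, the distal points
form a dense `Gδ` set, and a second use of Baire category, first in `X_max` and then in a fiber,
gives a fiber in which they are dense. Being at most `n` in number there, they are the whole fiber,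
so `mr ≤ cr`. -/

theorem not_proximal_of_le_dist {δ : ℝ} (hδ : 0 < δ) {x y : X}
    (h : ∀ t : G, δ ≤ dist (t • x) (t • y)) : ¬ Proximal G X x y := fun hp =>
  let ⟨t, ht⟩ := hp δ hδ
  (h t).not_gt ht

theorem Proximal.symm {x y : X} (h : Proximal G X x y) : Proximal G X y x := fun ε hε =>
  let ⟨t, ht⟩ := h ε hε
  ⟨t, by rwa [dist_comm]⟩

variable (G X) in
/-- The `n`-tuples in a common fiber of `π_max` whose entries stay `δ`-apart under the action. -/
def separatedTuples (δ : ℝ) (n : ℕ) : Set (Fin n → X) :=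
  {a | (∀ i j, piMax G X (a i) = piMax G X (a j)) ∧
    ∀ i j, i ≠ j → ∀ t : G, δ ≤ dist (t • a i) (t • a j)}

theorem smul_mem_separatedTuples {δ : ℝ} {n : ℕ} {a : Fin n → X}
    (ha : a ∈ separatedTuples G X δ n) (t : G) : t • a ∈ separatedTuples G X δ n := by
  refine ⟨fun i j => ?_, fun i j hij s => ?_⟩
  · simp only [Pi.smul_apply, (isFactorMap_piMax G X).map_smul, ha.1 i j]
  · simpa only [Pi.smul_apply, smul_smul] using ha.2 i j hij (s * t)

theorem encard_range_of_mem_separatedTuples {δ : ℝ} (hδ : 0 < δ) {n : ℕ} {a : Fin n → X}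
    (ha : a ∈ separatedTuples G X δ n) : (range a).encard = n := by
  have hinj : Function.Injective a := by
    intro i j hij
    by_contra hne
    have := ha.2 i j hne 1
    rw [hij, dist_self] at this
    exact this.not_gt hδ
  rw [← image_univ, hinj.encard_image, encard_univ, ENat.card_eq_coe_fintype_card,
    Fintype.card_fin]

theorem pairwise_not_proximal_range {δ : ℝ} (hδ : 0 < δ) {n : ℕ} {a : Fin n → X}
    (ha : a ∈ separatedTuples G X δ n) :
    (range a).Pairwise fun x y => ¬ Proximal G X x y := by
  rintro _ ⟨i, rfl⟩ _ ⟨j, rfl⟩ hne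
  exact not_proximal_of_le_dist hδ (ha.2 i j fun h => hne (congrArg a h))

theorem encard_le_coincidenceRank {S : Set X} {ξ : MaxEquicontinuousFactor G X}
    (hS : S ⊆ fiber G X ξ) (hp : S.Pairwise fun x y => ¬ Proximal G X x y) :
    S.encard ≤ coincidenceRank G X :=
  le_iSup_of_le ξ (le_iSup₂_of_le (f := fun (S : Set X) _ => S.encard) S ⟨hS, hp⟩ le_rfl)

theorem smul_mem_distalPoints {x : X} (hx : x ∈ distalPoints G X) (t : G) :
    t • x ∈ distalPoints G X := by
  intro y hy
  rw [← hx (t⁻¹ • y) fun ε hε => ?_, smul_inv_smul]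
  obtain ⟨s, hs⟩ := hy ε hε
  exact ⟨s * t, by simpa [mul_smul] using hs⟩

theorem isClosed_separatedTuples [ContinuousConstSMul G X] (δ : ℝ) (n : ℕ) : IsClosed (separatedTuples G X δ n) := by
  have hπ := (isFactorMap_piMax G X).continuous
  simp only [separatedTuples, ne_eq, ofPred_and, ofPred_forall]
  refine IsClosed.inter ?_ ?_
  · exact isClosed_iInter fun i => isClosed_iInter fun j =>
      isClosed_eq (hπ.comp (continuous_apply i)) (hπ.comp (continuous_apply j))
  · exact isClosed_iInter fun i => isClosed_iInter fun j => isClosed_iInter fun _ =>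
      isClosed_iInter fun t => isClosed_le continuous_const
        (((continuous_apply i).const_smul t).dist ((continuous_apply j).const_smul t))

/-- A finite coincidence rank is attained by a tuple with uniformly separated orbits. -/
theorem exists_separatedTuples_nonempty [Nonempty X] (hcr : coincidenceRank G X < ⊤) :
    ∃ n : ℕ, 0 < n ∧ coincidenceRank G X = n ∧
      ∃ δ > 0, (separatedTuples G X δ n).Nonempty := by
  obtain ⟨n, hn⟩ := ENat.ne_top_iff_exists.1 hcr.ne
  have hpos : 0 < n := by
    obtain ⟨x⟩ := ‹Nonempty X›
    have h := encard_le_coincidenceRank (G := G) (S := {x}) (ξ := piMax G X x)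
      (by rintro _ rfl; rfl) (pairwise_singleton _ _)
    rw [encard_singleton, ← hn] at h
    exact_mod_cast h
  refine ⟨n, hpos, hn.symm, ?_⟩
  -- The supremum is a finite integer `n ≥ 1`, so a set with more than `n - 1` points has exactly
  -- `n`.
  have hlt : ((n - 1 : ℕ) : ℕ∞) < coincidenceRank G X := by
    rw [← hn]
    exact_mod_cast Nat.sub_lt hpos one_pos
  obtain ⟨ξ, hξ⟩ := lt_iSup_iff.1 hlt
  obtain ⟨S, hS⟩ := lt_iSup_iff.1 hξ
  obtain ⟨⟨hSf, hSp⟩, hS⟩ := lt_iSup_iff.1 hS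
  have hle : S.encard ≤ n := hn ▸ encard_le_coincidenceRank hSf hSp
  have hfin : S.Finite := finite_of_encard_le_coe hle
  have hcard : S.ncard = n := by
    rw [← hfin.cast_ncard_eq] at hle hS
    have h1 : S.ncard ≤ n := by exact_mod_cast hle
    have h2 : n - 1 < S.ncard := by exact_mod_cast hS
    omega
  have := hfin.fintype
  have hcard' : Fintype.card S = n := by rw [← hcard, Set.ncard_eq_toFinset_card', toFinset_card]
  let e : Fin n ≃ S := (Fintype.equivFinOfCardEq hcard').symm
  have hsep : ∀ p : Fin n × Fin n, ∃ δ > 0, p.1 ≠ p.2 →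
      ∀ t : G, δ ≤ dist (t • (e p.1 : X)) (t • (e p.2 : X)) := by
    rintro ⟨i, j⟩
    by_cases hij : i = j
    -- A dummy value on the diagonal, so that `δ` can be a minimum over all pairs.
    · exact ⟨1, one_pos, fun h => (h hij).elim⟩
    · have := hSp (e i).2 (e j).2 fun h => hij (e.injective (Subtype.ext h))
      simp only [Proximal, ProxWithin] at this
      push Not at this
      obtain ⟨ε, hε, h⟩ := this
      exact ⟨ε, hε, fun _ => h⟩
  choose d hd hd' using hsep
  have hne : (Finset.univ : Finset (Fin n × Fin n)).Nonempty := ⟨(⟨0, hpos⟩, ⟨0, hpos⟩), by simp⟩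
  refine ⟨Finset.univ.inf' hne d, (Finset.lt_inf'_iff hne).2 fun p _ => hd p,
    fun i => e i, fun i j => ?_, fun i j hij t => ?_⟩
  · exact (hSf (e i).2 : piMax G X (e i) = ξ).trans (hSf (e j).2 : piMax G X (e j) = ξ).symm
  · exact (Finset.inf'_le d (Finset.mem_univ (i, j))).trans (hd' (i, j) hij t)

/-- The number of points in a fiber-open fiber is at most that in any fiber. -/
theorem encard_fiber_le_of_mem_fiberOpenPoints [MulAction.IsMinimal G X]
    {ξ ζ : MaxEquicontinuousFactor G X}
    (hξ : ξ ∈ fiberOpenPoints G X) : (fiber G X ξ).encard ≤ (fiber G X ζ).encard := by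
  by_contra! hlt
  -- Take one point more in the fiber of `ξ` than the fiber of `ζ` has. Openness lifts each point
  -- near `ξ` into disjoint neighbourhoods of all of these; minimality moves `ζ` near `ξ`, and `t⁻¹`
  -- carries the lifts back to too many points over `ζ`.
  obtain ⟨S, hS, hcard⟩ := exists_subset_encard_eq (Order.add_one_le_of_lt hlt)
  have hfinζ : (fiber G X ζ).encard ≠ ⊤ := hlt.ne_top
  have hSfin : S.Finite := by
    rw [← encard_ne_top_iff, hcard]
    simpa using hfinζ
  obtain ⟨U, hU, hdisj⟩ := hSfin.t2_separation
  have hnhds : (⋂ x ∈ S, piMax G X '' U x) ∈ 𝓝 ξ := by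
    refine (biInter_mem hSfin).2 fun x hx => ?_
    have h := hξ (hS hx) (U x) ((hU x).2.mem_nhds (hU x).1)
    rwa [(hS hx : piMax G X x = ξ)] at h
  obtain ⟨z, rfl⟩ := (isFactorMap_piMax G X).surjective ζ
  obtain ⟨O, hO, hOo, hξO⟩ := mem_nhds_iff.1 hnhds
  obtain ⟨x, rfl⟩ := (isFactorMap_piMax G X).surjective ξ
  obtain ⟨t, ht⟩ := (hOo.preimage (isFactorMap_piMax G X).continuous).exists_smul_mem G z ⟨x, hξO⟩
  have hsel : ∀ s : S, ∃ y ∈ U s, piMax G X y = piMax G X (t • z) := fun s =>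
    mem_iInter₂.1 (hO ht) s s.2
  choose f hfU hf using hsel
  have hinj : Function.Injective fun s : S => t⁻¹ • f s := by
    intro s s' hss
    have hss' : f s = f s' := smul_left_cancel _ hss
    by_contra hne
    exact disjoint_left.1 (hdisj s.2 s'.2 fun h => hne (Subtype.ext h)) (hfU s) (hss' ▸ hfU s')
  have hsub : range (fun s : S => t⁻¹ • f s) ⊆ fiber G X (piMax G X z) := by
    rintro _ ⟨s, rfl⟩
    change piMax G X (t⁻¹ • f s) = piMax G X z
    rw [(isFactorMap_piMax G X).map_smul, hf, (isFactorMap_piMax G X).map_smul, inv_smul_smul]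
  have h := encard_le_encard hsub
  rw [← image_univ, hinj.encard_image, encard_univ, ← Set.encard, hcard] at h
  exact (ENat.add_one_le_iff hfinζ).1 h |>.false

end Metric

/-! ### Compactness and minimality: tuples over every fiber -/

section Minimal

variable {G : Type v} [Group G] {X : Type u} [MetricSpace X] [CompactSpace X] [MulAction G X]

/-- Proximal points have the same image in the maximal equicontinuous factor. -/
theorem Proximal.piMax_eq {x y : X} (h : Proximal G X x y) : piMax G X x = piMax G X y := by
  by_contra hne
  have hU : {(piMax G X x, piMax G X y)}ᶜ ∈ 𝓝ˢ (diagonal (MaxEquicontinuousFactor G X)) := by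
    refine isOpen_compl_singleton.mem_nhdsSet.2 ?_
    rintro ⟨a, b⟩ (rfl : a = b) hab
    simp only [mem_singleton_iff, Prod.mk.injEq] at hab
    exact hne (hab.1.symm.trans hab.2)
  obtain ⟨V, hV, hVU⟩ := isEquicontinuous_max G X _ hU
  have hc : Continuous (Prod.map (piMax G X) (piMax G X)) :=
    (isFactorMap_piMax G X).continuous.prodMap (isFactorMap_piMax G X).continuous
  have hmaps : MapsTo (Prod.map (piMax G X) (piMax G X)) (diagonal X)
      (diagonal (MaxEquicontinuousFactor G X)) := by
    rintro ⟨a, b⟩ (rfl : a = b)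
    rfl
  have hV' := hc.tendsto_nhdsSet hmaps hV
  rw [nhdsSet_diagonal_eq_uniformity] at hV'
  obtain ⟨ε, hε, hεV⟩ := Metric.mem_uniformity_dist.1 hV'
  obtain ⟨t, ht⟩ := h ε hε
  -- The translated pair is close, so by equicontinuity applying `t⁻¹` cannot return it to the
  -- excluded pair.
  have hmem : (t • piMax G X x, t • piMax G X y) ∈ V := hεV ht
  have := hVU _ hmem t⁻¹
  simp at this

variable [TopologicalSpace G] [ContinuousSMul G X]

variable [MulAction.IsMinimal G X]

/-- In a minimal system every point is an entry of a separated tuple, once there is one. -/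
theorem exists_mem_separatedTuples_apply_eq {δ : ℝ} {n : ℕ} (hn : 0 < n)
    (hne : (separatedTuples G X δ n).Nonempty) (x : X) :
    ∃ a ∈ separatedTuples G X δ n, ∃ i, a i = x := by
  have hcl : IsClosed ((fun a : Fin n → X => a ⟨0, hn⟩) '' separatedTuples G X δ n) :=
    ((isClosed_separatedTuples δ n).isCompact.image (continuous_apply _)).isClosed
  have hinv : ∀ t : G, t • ((fun a : Fin n → X => a ⟨0, hn⟩) '' separatedTuples G X δ n) ⊆
      (fun a : Fin n → X => a ⟨0, hn⟩) '' separatedTuples G X δ n := by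
    rintro t _ ⟨_, ⟨a, ha, rfl⟩, rfl⟩
    exact ⟨t • a, smul_mem_separatedTuples ha t, rfl⟩
  rcases eq_empty_or_univ_of_smul_invariant_closed G hcl hinv with h | h
  · exact absurd h (hne.image _).ne_empty
  · obtain ⟨a, ha, hax⟩ := h.symm ▸ mem_univ x
    exact ⟨a, ha, _, hax⟩

theorem exists_mem_separatedTuples_range_subset {δ : ℝ} {n : ℕ} (hn : 0 < n)
    (hne : (separatedTuples G X δ n).Nonempty) (ξ : MaxEquicontinuousFactor G X) :
    ∃ a ∈ separatedTuples G X δ n, range a ⊆ fiber G X ξ := by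
  obtain ⟨x, rfl⟩ := (isFactorMap_piMax G X).surjective ξ
  obtain ⟨a, ha, i, rfl⟩ := exists_mem_separatedTuples_apply_eq hn hne x
  refine ⟨a, ha, ?_⟩
  rintro _ ⟨j, rfl⟩
  exact ha.1 j i

/-- A tuple attaining the coincidence rank in one fiber can be found in every fiber. -/
theorem coincidenceRank_le_encard_fiber [Nonempty X] (hcr : coincidenceRank G X < ⊤)
    (ξ : MaxEquicontinuousFactor G X) : coincidenceRank G X ≤ (fiber G X ξ).encard := by
  obtain ⟨n, hn, hcrn, δ, hδ, hne⟩ := exists_separatedTuples_nonempty hcr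
  obtain ⟨a, ha, haξ⟩ := exists_mem_separatedTuples_range_subset hn hne ξ
  rw [hcrn, ← encard_range_of_mem_separatedTuples hδ ha]
  exact encard_le_encard haξ

theorem coincidenceRank_le_minimalRank [Nonempty X] (hcr : coincidenceRank G X < ⊤) :
    coincidenceRank G X ≤ minimalRank G X :=
  le_iInf (coincidenceRank_le_encard_fiber hcr)

/-- A fiber with at most `cr < ∞` points is distal. -/
theorem mem_fiberDistalPoints_of_encard_le [Nonempty X] (hcr : coincidenceRank G X < ⊤)
    {ξ : MaxEquicontinuousFactor G X} (hξ : (fiber G X ξ).encard ≤ coincidenceRank G X) :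
    ξ ∈ fiberDistalPoints G X := by
  obtain ⟨n, hn, hcrn, δ, hδ, hne⟩ := exists_separatedTuples_nonempty hcr
  obtain ⟨a, ha, haξ⟩ := exists_mem_separatedTuples_range_subset hn hne ξ
  have heq : range a = fiber G X ξ := (finite_range a).eq_of_subset_of_encard_le haξ
    (by rwa [encard_range_of_mem_separatedTuples hδ ha, ← hcrn])
  intro x hx y hxy
  have hy : y ∈ fiber G X ξ := (hxy.piMax_eq).symm.trans hx
  by_contra hyx
  exact pairwise_not_proximal_range hδ ha (heq ▸ hx) (heq ▸ hy) (Ne.symm hyx) hxy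

/-- A fiber-distal point is fiber-open if `cr < ∞`. -/
theorem fiberDistalPoints_subset_fiberOpenPoints [Nonempty X]
    (hcr : coincidenceRank G X < ⊤) : fiberDistalPoints G X ⊆ fiberOpenPoints G X := by
  intro ξ hξ
  obtain ⟨n, hn, hcrn, δ, hδ, hne⟩ := exists_separatedTuples_nonempty hcr
  have hle : (fiber G X ξ).encard ≤ n := by
    rw [← hcrn]
    exact encard_le_coincidenceRank subset_rfl fun x hx y _ hxy hp => hxy (hξ hx y hp).symm
  rintro x (rfl : piMax G X x = ξ) U hU
  obtain ⟨O, hOU, hO, hxO⟩ := mem_nhds_iff.1 hU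
  -- Tuples avoiding `O`. None lies over `ξ`, since there a tuple exhausts the fiber and so contains
  -- `x`; as `C` is compact, none lies over points near `ξ`, where some tuple exists and must meet
  -- `O`.
  let C : Set (Fin n → X) := separatedTuples G X δ n ∩ ⋂ i, (fun a => a i) ⁻¹' Oᶜ
  have hC : IsClosed C := (isClosed_separatedTuples δ n).inter
    (isClosed_iInter fun i => hO.isClosed_compl.preimage (continuous_apply i))
  have hcl : IsClosed ((fun a : Fin n → X => piMax G X (a ⟨0, hn⟩)) '' C) :=
    (hC.isCompact.image ((isFactorMap_piMax G X).continuous.comp (continuous_apply _))).isClosed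
  refine mem_of_superset (hcl.isOpen_compl.mem_nhds ?_) ?_
  · rintro ⟨a, ⟨ha, haO⟩, hax⟩
    have haf : range a ⊆ fiber G X (piMax G X x) := by
      rintro _ ⟨i, rfl⟩
      exact (ha.1 i ⟨0, hn⟩).trans hax
    have heq := (finite_range a).eq_of_subset_of_encard_le haf
      (by rwa [encard_range_of_mem_separatedTuples hδ ha])
    obtain ⟨i, rfl⟩ := heq.superset (show x ∈ fiber G X (piMax G X x) from rfl)
    exact mem_iInter.1 haO i hxO
  · intro η hη
    obtain ⟨a, ha, haη⟩ := exists_mem_separatedTuples_range_subset hn hne η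
    by_contra hcon
    refine hη ⟨a, ⟨ha, mem_iInter.2 fun i hi => hcon ⟨a i, hOU hi, haη ⟨i, rfl⟩⟩⟩, haη ⟨_, rfl⟩⟩

/-! ### Semi-openness and generic fibers -/

/-- The factor map of a minimal system is semi-open. -/
theorem nonempty_interior_image_piMax {O : Set X} (hO : IsOpen O) (hne : O.Nonempty) :
    (interior (piMax G X '' O)).Nonempty := by
  obtain ⟨x, hx⟩ := hne
  -- The images of finitely many translates of `K` are closed and cover `X_max`, so one has
  -- interior.
  obtain ⟨K, hK, hKc, hKO⟩ := exists_mem_nhds_isClosed_subset (hO.mem_nhds hx)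
  obtain ⟨I, hI⟩ := isCompact_univ.exists_finite_cover_smul G (isOpen_interior (s := K))
    ⟨x, mem_interior_iff_mem_nhds.2 hK⟩
  have hKim : IsClosed (piMax G X '' K) :=
    (hKc.isCompact.image (isFactorMap_piMax G X).continuous).isClosed
  have : Nonempty (MaxEquicontinuousFactor G X) := ⟨piMax G X x⟩
  obtain ⟨t, ht⟩ := nonempty_interior_of_iUnion_of_closed
    (f := fun t : I => (t : G) • (piMax G X '' K)) (fun t => hKim.smul (t : G)) (by
      refine eq_univ_of_forall fun η => ?_
      obtain ⟨y, rfl⟩ := (isFactorMap_piMax G X).surjective η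
      obtain ⟨t, htI, w, hw, rfl⟩ := mem_iUnion₂.1 (hI (mem_univ y))
      exact mem_iUnion.2 ⟨⟨t, htI⟩, piMax G X w, ⟨w, interior_subset hw, rfl⟩, rfl⟩)
  rw [interior_smul] at ht
  exact (smul_set_nonempty.1 ht).mono (interior_mono (image_mono hKO))

/-- For generic `ξ`, if the fiber of `ξ` meets the open set `V`, then `ξ` is interior to the image
of `V ∩ U`, where `U` is open and dense. -/
theorem dense_compl_closure_image_diff {V U : Set X} (hV : IsOpen V) (hU : IsOpen U)
    (hUd : Dense U) :
    Dense (closure (piMax G X '' V \ interior (piMax G X '' (V ∩ U))))ᶜ := by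
  rw [← interior_eq_empty_iff_dense_compl, ← not_nonempty_iff_eq_empty]
  intro hne
  set B := piMax G X '' V \ interior (piMax G X '' (V ∩ U)) with hB
  obtain ⟨_, hyN, ⟨y, hyV, rfl⟩, -⟩ := mem_closure_iff.1 (interior_subset hne.some_mem) _
    isOpen_interior hne.some_mem
  -- If `B` were dense in some open set, semi-openness would put an open part of that set inside the
  -- image of `V ∩ U`, whose interior `B` avoids.
  have hO : IsOpen ((piMax G X ⁻¹' interior (closure B)) ∩ V) :=
    (isOpen_interior.preimage (isFactorMap_piMax G X).continuous).inter hV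
  obtain ⟨η, hη⟩ := nonempty_interior_image_piMax (G := G) (hO.inter hU)
    (hUd.inter_open_nonempty _ hO ⟨y, hyN, hyV⟩)
  have hηB : η ∈ closure B := by
    obtain ⟨w, ⟨⟨hw, -⟩, -⟩, rfl⟩ := interior_subset hη
    exact interior_subset hw
  obtain ⟨ζ, hζ, hζB⟩ := mem_closure_iff.1 hηB _ isOpen_interior hη
  refine hζB.2 (interior_mono (image_mono ?_) hζ)
  rintro w ⟨⟨-, hw⟩, hw'⟩
  exact ⟨hw, hw'⟩

/-- For countably many dense open sets `U m` of `X` there is a fiber-open `ξ` such that every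
`U m` is dense in the fiber of `ξ`. -/
theorem exists_forall_mem_interior_image [Nonempty X] {U : ℕ → Set X} (hU : ∀ m, IsOpen (U m))
    (hUd : ∀ m, Dense (U m)) :
    ∃ ξ : MaxEquicontinuousFactor G X, ∀ m, ∀ x ∈ fiber G X ξ, ∀ W ∈ 𝓝 x,
      piMax G X '' (W ∩ U m) ∈ 𝓝 ξ := by
  obtain ⟨b, hbc, -, hb⟩ := TopologicalSpace.exists_countable_basis X
  have := hbc.to_subtype
  have : Nonempty (MaxEquicontinuousFactor G X) := ‹Nonempty X›.map (piMax G X)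
  obtain ⟨ξ, hξ⟩ := (dense_iInter_of_isOpen
    (f := fun p : b × ℕ =>
      (closure (piMax G X '' (p.1 : Set X) \ interior (piMax G X '' (p.1 ∩ U p.2))))ᶜ)
    (fun p => isClosed_closure.isOpen_compl)
    (fun p => dense_compl_closure_image_diff (hb.isOpen p.1.2) (hU p.2) (hUd p.2))).nonempty
  refine ⟨ξ, fun m x hx W hW => ?_⟩
  obtain ⟨V, hVb, hxV, hVW⟩ := hb.mem_nhds_iff.1 hW
  have h := mem_iInter.1 hξ (⟨V, hVb⟩, m)
  have hmem : ξ ∈ interior (piMax G X '' (V ∩ U m)) := by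
    by_contra hcon
    exact h (subset_closure ⟨⟨x, hxV, hx⟩, hcon⟩)
  exact mem_of_superset (mem_interior_iff_mem_nhds.1 hmem)
    (image_mono (inter_subset_inter_left _ hVW))

theorem fiberOpenPoints_nonempty [Nonempty X] : (fiberOpenPoints G X).Nonempty := by
  obtain ⟨ξ, hξ⟩ := exists_forall_mem_interior_image (G := G) (X := X) (U := fun _ => univ)
    (fun _ => isOpen_univ) (fun _ => dense_univ)
  refine ⟨ξ, fun x hx W hW => ?_⟩
  have h := hξ 0 x hx W hW
  rwa [inter_univ, ← (hx : piMax G X x = ξ)] at h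

/-! ### Distal points and Baire category -/

/-- If `cr < ∞`, the distal points form a `Gδ` set. -/
theorem isGδ_distalPoints [Nonempty X] (hcr : coincidenceRank G X < ⊤) :
    ∃ U : ℕ → Set X, (∀ m, IsOpen (U m)) ∧ distalPoints G X = ⋂ m, U m := by
  obtain ⟨n, hn, hcrn, δ, hδ, hne⟩ := exists_separatedTuples_nonempty hcr
  -- The non-distal points are exactly those missed by some separated tuple of their own fiber: a
  -- distal point could be added to the tuple, exceeding `cr`, while a tuple through a distinct
  -- proximal point misses `y`. The bound `1 / (m + 1)` splits this into compact pieces.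
  let C : ℕ → Set ((Fin n → X) × X) := fun m =>
    {p | p.1 ∈ separatedTuples G X δ n ∧ piMax G X (p.1 ⟨0, hn⟩) = piMax G X p.2 ∧
      ∀ i, 1 / ((m : ℝ) + 1) ≤ dist p.2 (p.1 i)}
  have hπ := (isFactorMap_piMax G X).continuous
  have hC : ∀ m, IsClosed (C m) := by
    intro m
    have hCm : C m = Prod.fst ⁻¹' separatedTuples G X δ n ∩
        ({p | piMax G X (p.1 ⟨0, hn⟩) = piMax G X p.2} ∩
          ⋂ i, {p | 1 / ((m : ℝ) + 1) ≤ dist p.2 (p.1 i)}) := by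
      ext p
      simp [C]
    rw [hCm]
    exact ((isClosed_separatedTuples δ n).preimage continuous_fst).inter
      ((isClosed_eq (by fun_prop) (by fun_prop)).inter
        (isClosed_iInter fun i => isClosed_le continuous_const (by fun_prop)))
  refine ⟨fun m => (Prod.snd '' C m)ᶜ,
    fun m => ((hC m).isCompact.image continuous_snd).isClosed.isOpen_compl, ?_⟩
  ext y
  simp only [mem_iInter]
  constructor
  · rintro hy m ⟨⟨a, z⟩, ⟨ha, haz, hdist⟩, rfl : z = y⟩
    have hz : z ∉ range a := by
      rintro ⟨i, rfl⟩
      have := hdist i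
      rw [dist_self] at this
      exact this.not_gt (by positivity)
    have hle : (insert z (range a)).encard ≤ coincidenceRank G X := by
      refine encard_le_coincidenceRank (ξ := piMax G X z) ?_ ?_
      · rintro _ (rfl | ⟨i, rfl⟩)
        · rfl
        · exact (ha.1 i ⟨0, hn⟩).trans haz
      · refine (pairwise_not_proximal_range hδ ha).insert_of_notMem hz fun w hw => ?_
        exact ⟨fun h => hz (hy w h ▸ hw), fun h => hz (hy w h.symm ▸ hw)⟩
    rw [encard_insert_of_notMem hz, encard_range_of_mem_separatedTuples hδ ha, hcrn] at hle
    exact (ENat.add_one_le_iff (ENat.natCast_ne_top n)).1 hle |>.false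
  · intro hy z hyz
    by_contra hzy
    obtain ⟨a, ha, j, rfl⟩ := exists_mem_separatedTuples_apply_eq hn hne z
    have hya : y ∉ range a := by
      rintro ⟨i, rfl⟩
      exact pairwise_not_proximal_range hδ ha ⟨i, rfl⟩ ⟨j, rfl⟩ (Ne.symm hzy) hyz
    have hclosed : IsClosed (range a) := (finite_range a).isClosed
    obtain ⟨ε, hε, hball⟩ := Metric.isOpen_iff.1 hclosed.isOpen_compl y hya
    obtain ⟨m, hm⟩ := exists_nat_one_div_lt hε
    refine hy m ⟨(a, y), ⟨ha, (ha.1 _ j).trans (hyz.piMax_eq).symm, fun i => ?_⟩, rfl⟩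
    by_contra! hlt
    exact hball (by rw [Metric.mem_ball, dist_comm]; exact hlt.trans hm) ⟨i, rfl⟩

/-- In a point distal system with `cr < ∞` some fiber has at most `cr` points. -/
theorem exists_encard_fiber_le_of_isPointDistal [Nonempty X] (hcr : coincidenceRank G X < ⊤)
    (hpd : IsPointDistal G X) :
    ∃ ξ : MaxEquicontinuousFactor G X, (fiber G X ξ).encard ≤ coincidenceRank G X := by
  obtain ⟨U, hU, hDU⟩ := isGδ_distalPoints hcr
  have hD : Dense (distalPoints G X) := dense_of_nonempty_smul_invariant G hpd <| by
    rintro t _ ⟨x, hx, rfl⟩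
    exact smul_mem_distalPoints hx t
  obtain ⟨ξ, hξ⟩ := exists_forall_mem_interior_image (G := G) hU
    fun m => hD.mono (hDU.trans_subset (iInter_subset U m))
  refine ⟨ξ, ?_⟩
  have hF : IsClosed (fiber G X ξ) := isClosed_singleton.preimage (isFactorMap_piMax G X).continuous
  have : CompactSpace (fiber G X ξ) := isCompact_iff_compactSpace.1 hF.isCompact
  -- Baire category inside the compact fiber, where every `U m` is dense.
  have hdense : Dense (⋂ m, ((↑) : fiber G X ξ → X) ⁻¹' U m) := by
    refine dense_iInter_of_isOpen (fun m => (hU m).preimage continuous_subtype_val) fun m x => ?_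
    refine mem_closure_iff_nhds.2 fun T hT => ?_
    obtain ⟨W, hW, hWT⟩ := mem_nhds_subtype _ _ _ |>.1 hT
    obtain ⟨w, ⟨hwW, hwU⟩, hw⟩ := mem_of_mem_nhds (hξ m x x.2 W hW)
    exact ⟨⟨w, hw⟩, hWT hwW, hwU⟩
  rw [← preimage_iInter, ← hDU] at hdense
  have hle : (fiber G X ξ ∩ distalPoints G X).encard ≤ coincidenceRank G X :=
    encard_le_coincidenceRank inter_subset_left
      fun x hx y _ hxy hp => hxy (hx.2 y hp).symm
  have hfin : (fiber G X ξ ∩ distalPoints G X).Finite :=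
    encard_lt_top_iff.1 (hle.trans_lt hcr)
  -- Finite, hence closed, and dense: the distal points fill the fiber.
  have hcl : IsClosed (((↑) : fiber G X ξ → X) ⁻¹' distalPoints G X) := by
    rw [← Subtype.preimage_coe_self_inter]
    exact hfin.isClosed.preimage continuous_subtype_val
  have huniv := hcl.closure_eq.symm.trans hdense.closure_eq
  have hsub : fiber G X ξ ⊆ fiber G X ξ ∩ distalPoints G X := fun x hx =>
    ⟨hx, eq_univ_iff_forall.1 huniv ⟨x, hx⟩⟩
  exact (encard_le_encard hsub).trans hle

end Minimal

end TopDyn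

theorem mainTheorem7 {G : Type v} [CommGroup G] [TopologicalSpace G] [IsTopologicalGroup G]
    [T2Space G] [LocallyCompactSpace G] [SigmaCompactSpace G]
    {X : Type u} [MetricSpace X] [CompactSpace X] [Nonempty X]
    [MulAction G X] [ContinuousSMul G X] [MulAction.IsMinimal G X]
    (hcr : TopDyn.coincidenceRank G X < ⊤) :
    List.TFAE [
      TopDyn.coincidenceRank G X = TopDyn.minimalRank G X,
      (TopDyn.fiberDistalPoints G X).Nonempty,
      TopDyn.IsPointDistal G X,
      TopDyn.fiberDistalPoints G X = TopDyn.fiberOpenPoints G X] := by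
  have : Nonempty (TopDyn.MaxEquicontinuousFactor G X) := ‹Nonempty X›.map (TopDyn.piMax G X)
  tfae_have 1 → 4 := by
    intro h
    refine (TopDyn.fiberDistalPoints_subset_fiberOpenPoints hcr).antisymm fun ξ hξ => ?_
    refine TopDyn.mem_fiberDistalPoints_of_encard_le hcr ?_
    rw [h]
    exact le_iInf fun ζ => TopDyn.encard_fiber_le_of_mem_fiberOpenPoints hξ
  tfae_have 4 → 2 := fun h => h ▸ TopDyn.fiberOpenPoints_nonempty
  tfae_have 2 → 3 := by
    rintro ⟨ξ, hξ⟩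
    obtain ⟨x, rfl⟩ := (TopDyn.isFactorMap_piMax G X).surjective ξ
    exact ⟨x, hξ rfl⟩
  tfae_have 3 → 1 := by
    intro h
    obtain ⟨ξ, hξ⟩ := TopDyn.exists_encard_fiber_le_of_isPointDistal hcr h
    exact (TopDyn.coincidenceRank_le_minimalRank hcr).antisymm ((iInf_le _ ξ).trans hξ)
  tfae_finish
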